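/- All graphs are finite and simple. A hole is a chordless cycle with at least five vertices. The paraglider is the graph with five vertices, four of which induce a diamond ($K_4$ minus one edge), while the fifth vertex is adjacent to exactly the two vertices of degree two in the diamond. A clique separator of a graph $G=(V,E)$ is a clique $K\subseteq V$ such that $G[V\setminus K]$ has more connected components than $G$; an atom is a graph without clique separator. A matched co-bipartite graph is a graph whose vertex set is the union of two disjoint cliques $L$ and $R$ of the same size $k$ such that the edges between $L$ and $R$ form a matching with $k$ edges. Theorem. Let $G$ be a connected atom that contains neither a hole nor the paraglider as an induced subgraph. Let $A$ be a set of vertices of $G$ that induces a $\overline{C_6}$ (the complement of the chordless cycle with six vertices), and let $A_6$ be the set of vertices of $G$ that are adjacent to all vertices of $A$. Then $G\setminus A_6=G[V(G)\setminus A_6]$ is a matched co-bipartite graph. -/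

import Mathlib

/-- A hole is a chordless cycle `C_n` with `n ≥ 5`; `G` is hole-free if no hole occurs in `G`
as an induced subgraph. -/
def HoleFree {V : Type*} (G : SimpleGraph V) : Prop :=
  ∀ n : ℕ, 5 ≤ n → ¬ (SimpleGraph.cycleGraph n).IsIndContained G

/-- The paraglider: the vertices `0, 1, 2, 3` induce a diamond (`K_4` minus the edge `01`), and the
fifth vertex `4` is adjacent exactly to `0` and `1`, the two vertices of degree two in the
diamond. -/
def paraglider : SimpleGraph (Fin 5) :=
  SimpleGraph.fromEdgeSet {s(0, 2), s(0, 3), s(1, 2), s(1, 3), s(2, 3), s(4, 0), s(4, 1)}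

/-- No induced subgraph of `G` is isomorphic to the paraglider. -/
def ParagliderFree {V : Type*} (G : SimpleGraph V) : Prop :=
  ¬ paraglider.IsIndContained G

/-- A clique separator of `G` is a clique `K` such that `G[V ∖ K]` has more connected components
than `G`. -/
def IsCliqueSeparator {V : Type*} (G : SimpleGraph V) (K : Set V) : Prop :=
  G.IsClique K ∧
    Cardinal.mk G.ConnectedComponent < Cardinal.mk (G.induce Kᶜ).ConnectedComponent

/-- An atom is a graph without clique separator. -/
def IsAtomGraph {V : Type*} (G : SimpleGraph V) : Prop :=
  ∀ K : Set V, ¬ IsCliqueSeparator G K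

/-- The vertex set `A` induces a `co-C_6` in `G`. -/
def InducesCoC6 {V : Type*} (G : SimpleGraph V) (A : Set V) : Prop :=
  Nonempty (G.induce A ≃g (SimpleGraph.cycleGraph 6)ᶜ)

/-- The set of vertices of `G` that are adjacent to all vertices of `A` (such a vertex never lies
in `A`, as no vertex is adjacent to itself). -/
def universalVertices {V : Type*} (G : SimpleGraph V) (A : Set V) : Set V :=
  {v | ∀ a ∈ A, G.Adj v a}

/-- A matched co-bipartite graph: its vertex set is the disjoint union of two cliques `L` and `R`
of the same size, and the edges between `L` and `R` are exactly the pairs `{l, f l}`, for a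
bijection `f` from `L` to `R` (a perfect matching between `L` and `R`). -/
def IsMatchedCoBipartite {W : Type*} (H : SimpleGraph W) : Prop :=
  ∃ L R : Set W, L ∪ R = Set.univ ∧ Disjoint L R ∧ H.IsClique L ∧ H.IsClique R ∧
    ∃ f : L ≃ R, ∀ (l : L) (r : R), H.Adj l r ↔ f l = r

/-! Take a maximal matched pair of cliques `a`, `b` that covers `A` and has two columns inside `A`;
the `co-C_6` itself gives three columns. By `adj_all`, an outside vertex that sees `a i` and `b j`
with `i ≠ j` sees the whole pair. Such complete vertices form a clique `U`, since two non-adjacent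
ones would give a paraglider.

Let `X` be the other outside vertices. If a path in `X` joins a neighbour of some `a i` to a
neighbour of some `b j`, `i ≠ j`, then a shortest such path is a single edge whose ends form a new
column, as anything else closes to a hole (`IsLink.exists_column`). This contradicts maximality.

Without such paths, the neighbours in the pair of a component of `X` are pairwise adjacent; with `U`
they form a clique separator. Hence `X` is empty, and `U` is exactly `A_6`. -/

namespace SimpleGraph

variable {V ι : Type*} {G : SimpleGraph V}

/-- The families `a` and `b` are two cliques, the edges between which are the pairs `a i, b i`. -/
structure IsMatchedPair (G : SimpleGraph V) (a b : ι → V) : Prop where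
  left : ∀ i j, G.Adj (a i) (a j) ↔ i ≠ j
  right : ∀ i j, G.Adj (b i) (b j) ↔ i ≠ j
  cross : ∀ i j, G.Adj (a i) (b j) ↔ i = j

/-- The first `m + 1` terms of `f` form a chordless path. -/
def IsChordlessPath (G : SimpleGraph V) (f : ℕ → V) (m : ℕ) : Prop :=
  ∀ s t, s < t → t ≤ m → (G.Adj (f s) (f t) ↔ t = s + 1)

/-- The sequence `f` runs, inside `X`, from a neighbour of some `a i` to a neighbour of some `b j`
with `i ≠ j`, in `m` steps. -/
def IsLink (G : SimpleGraph V) (a b : ι → V) (X : Set V) (f : ℕ → V) (m : ℕ) : Prop :=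
  (∀ t ≤ m, f t ∈ X) ∧ (∀ t < m, G.Adj (f t) (f (t + 1))) ∧
    ∃ i j, i ≠ j ∧ G.Adj (a i) (f 0) ∧ G.Adj (b j) (f m)

/-! ### Holes from chordless paths -/

theorem cycleGraph_adj_of_lt {n : ℕ} {i j : Fin n} (h : i < j) :
    (cycleGraph n).Adj i j ↔ j.val = i.val + 1 ∨ (i.val = 0 ∧ j.val = n - 1) := by
  have h' : i.val < j.val := h
  have hj := j.isLt
  rw [cycleGraph_adj', Fin.coe_sub_iff_lt.2 h, Fin.coe_sub_iff_le.2 h.le]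
  omega

/-- A cyclic sequence without chords, of length at least five, contradicts `HoleFree`. -/
theorem _root_.HoleFree.not_cycle (hG : HoleFree G) {n : ℕ} (hn : 5 ≤ n) (f : ℕ → V)
    (hf : ∀ s t, s < t → t < n → (G.Adj (f s) (f t) ↔ t = s + 1 ∨ (s = 0 ∧ t = n - 1))) :
    False := by
  have hadj : ∀ i j : Fin n, G.Adj (f i) (f j) ↔ (cycleGraph n).Adj i j := by
    intro i j
    rcases lt_trichotomy i j with h | h | h
    · rw [hf i j h j.isLt, cycleGraph_adj_of_lt h]
    · subst h; simp
    · rw [G.adj_comm, hf j i h i.isLt, adj_comm, cycleGraph_adj_of_lt h]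
  -- Equal terms would have the same neighbours, but distinct vertices of a cycle of length at least
  -- five never do.
  have hne : ∀ s t, s < t → t < n → f s ≠ f t := by
    intro s t hst ht he
    have h1 : t ≠ s + 1 := fun h => G.ne_of_adj ((hf s t hst ht).2 (Or.inl h)) he
    have h2 := (hf s (s + 1) (by omega) (by omega)).2 (Or.inl rfl)
    rw [he, G.adj_comm, hf (s + 1) t (by omega) ht] at h2
    by_cases h3 : t + 1 < n
    · have h4 := (hf t (t + 1) (by omega) h3).2 (Or.inl rfl)
      rw [← he, hf s (t + 1) (by omega) h3] at h4
      omega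
    · have h4 := (hf 0 t (by omega) ht).2 (Or.inr ⟨rfl, by omega⟩)
      rw [← he] at h4
      rcases Nat.eq_zero_or_pos s with h5 | h5
      · subst h5; exact G.loopless.irrefl _ h4
      · rw [hf 0 s h5 (by omega)] at h4
        omega
  refine hG n hn ⟨⟨⟨fun i => f i, ?_⟩, ?_⟩⟩
  · intro i j h
    rcases lt_trichotomy i j with h' | h' | h'
    · exact (hne i j h' j.isLt h).elim
    · exact h'
    · exact (hne j i h' i.isLt h.symm).elim
  · intro i j
    exact hadj i j

/-- A chordless path with at least four vertices cannot be closed by a further vertex. -/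
theorem _root_.HoleFree.not_closed (hG : HoleFree G) {f : ℕ → V} {m : ℕ} (hm : 3 ≤ m)
    (hf : G.IsChordlessPath f m) {p : V} (hp : ∀ s ≤ m, (G.Adj p (f s) ↔ s = 0 ∨ s = m)) :
    False := by
  refine hG.not_cycle (n := m + 2) (by omega) (fun t => if t ≤ m then f t else p) ?_
  intro s t hst ht
  by_cases h : t ≤ m
  · simp only [h, if_true, show s ≤ m by omega]
    rw [hf s t hst h]
    omega
  · simp only [h, if_false, show s ≤ m by omega, if_true]
    rw [G.adj_comm, hp s (by omega)]
    omega

theorem IsChordlessPath.extend {f : ℕ → V} {m : ℕ} (hf : G.IsChordlessPath f m) {p : V}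
    (hp : ∀ s ≤ m, (G.Adj p (f s) ↔ s = m)) :
    G.IsChordlessPath (fun t => if t ≤ m then f t else p) (m + 1) := by
  intro s t hst ht
  by_cases h : t ≤ m
  · simp only [h, if_true, show s ≤ m by omega]
    exact hf s t hst h
  · simp only [h, if_false, show s ≤ m by omega, if_true]
    rw [G.adj_comm, hp s (by omega)]
    omega

/-- A chordless path closed by an edge. -/
theorem _root_.HoleFree.not_closed_edge (hG : HoleFree G) {f : ℕ → V} {m : ℕ} (hm : 2 ≤ m)
    (hf : G.IsChordlessPath f m) {p q : V} (hp : ∀ s ≤ m, (G.Adj p (f s) ↔ s = m))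
    (hq : ∀ s ≤ m, (G.Adj q (f s) ↔ s = 0)) (hqp : G.Adj q p) : False := by
  refine hG.not_closed (by omega) (hf.extend hp) (p := q) ?_
  intro s hs
  by_cases h : s ≤ m
  · simp only [h, if_true, hq s h]
    omega
  · simp only [h, if_false, hqp, true_iff]
    omega

/-- A chordless path closed by a path with two edges. -/
theorem _root_.HoleFree.not_closed_path (hG : HoleFree G) {f : ℕ → V} {m : ℕ} (hm : 1 ≤ m)
    (hf : G.IsChordlessPath f m) {p q r : V} (hp : ∀ s ≤ m, (G.Adj p (f s) ↔ s = m))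
    (hq : ∀ s ≤ m, ¬ G.Adj q (f s)) (hr : ∀ s ≤ m, (G.Adj r (f s) ↔ s = 0))
    (hqp : G.Adj q p) (hrq : G.Adj r q) (hrp : ¬ G.Adj r p) : False := by
  refine hG.not_closed_edge (by omega) (hf.extend hp) (p := q) (q := r) ?_ ?_ hrq
  · intro s hs
    by_cases h : s ≤ m
    · simp only [h, if_true, hq s h, false_iff]
      omega
    · simp only [h, if_false, hqp, true_iff]
      omega
  · intro s hs
    by_cases h : s ≤ m
    · simp only [h, if_true, hr s h]
    · simp only [h, if_false, hrp, false_iff]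
      omega

theorem isChordlessPath_one {x y : V} (h : G.Adj x y) :
    G.IsChordlessPath (fun t => if t = 0 then x else y) 1 := by
  intro s t hst ht
  obtain rfl : s = 0 := by omega
  obtain rfl : t = 1 := by omega
  simpa using h

theorem _root_.HoleFree.not_cycle_five (hG : HoleFree G) {x y p q r : V} (hxy : G.Adj x y)
    (hyp : G.Adj y p) (hpq : G.Adj p q) (hqr : G.Adj q r) (hrx : G.Adj r x)
    (hxp : ¬ G.Adj x p) (hxq : ¬ G.Adj x q) (hyq : ¬ G.Adj y q) (hyr : ¬ G.Adj y r)
    (hpr : ¬ G.Adj p r) : False := by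
  refine hG.not_closed_path le_rfl (isChordlessPath_one hxy) (p := p) (q := q) (r := r)
    ?_ ?_ ?_ hpq.symm hqr.symm (fun h => hpr h.symm)
  all_goals
    intro s hs
    obtain rfl | rfl : s = 0 ∨ s = 1 := by omega
    all_goals simp_all [G.adj_comm]

theorem _root_.HoleFree.not_cycle_six (hG : HoleFree G) {x y z p q r : V} (hxy : G.Adj x y)
    (hyz : G.Adj y z) (hzp : G.Adj z p) (hpq : G.Adj p q) (hqr : G.Adj q r) (hrx : G.Adj r x)
    (hxz : ¬ G.Adj x z) (hxp : ¬ G.Adj x p) (hxq : ¬ G.Adj x q) (hyp : ¬ G.Adj y p)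
    (hyq : ¬ G.Adj y q) (hyr : ¬ G.Adj y r) (hzq : ¬ G.Adj z q) (hzr : ¬ G.Adj z r)
    (hpr : ¬ G.Adj p r) : False := by
  refine hG.not_closed_path (m := 2) (by omega)
    ((isChordlessPath_one hxy).extend (p := z) ?_) (p := p) (q := q) (r := r)
    ?_ ?_ ?_ hpq.symm hqr.symm (fun h => hpr h.symm)
  · intro s hs
    obtain rfl | rfl : s = 0 ∨ s = 1 := by omega
    all_goals simp_all [G.adj_comm]
  all_goals
    intro s hs
    obtain rfl | rfl | rfl : s = 0 ∨ s = 1 ∨ s = 2 := by omega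
    all_goals simp_all [G.adj_comm]

/-! ### Paragliders -/

theorem _root_.ParagliderFree.not_diamond (hG : ParagliderFree G) {p q r s t : V} (hne : p ≠ q)
    (hpq : ¬ G.Adj p q) (hpr : G.Adj p r) (hps : G.Adj p s) (hqr : G.Adj q r) (hqs : G.Adj q s)
    (hrs : G.Adj r s) (htp : G.Adj t p) (htq : G.Adj t q) (htr : ¬ G.Adj t r)
    (hts : ¬ G.Adj t s) : False := by
  have hrt : r ≠ t := fun h => hts (h ▸ hrs)
  have hst : s ≠ t := fun h => htr (h ▸ hrs.symm)
  have hinj : Function.Injective ![p, q, r, s, t] := by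
    have := hpr.ne
    have := hps.ne
    have := hqr.ne
    have := hqs.ne
    have := hrs.ne
    have := htp.ne
    have := htq.ne
    intro i j h
    fin_cases i <;> fin_cases j <;> simp_all
  have hadj : ∀ i j, G.Adj (![p, q, r, s, t] i) (![p, q, r, s, t] j) ↔ paraglider.Adj i j := by
    intro i j
    fin_cases i <;> fin_cases j <;> simp_all [paraglider, G.adj_comm]
  exact hG ⟨⟨⟨_, hinj⟩, hadj _ _⟩⟩

/-- A vertex with three neighbours on a chordless 4-cycle `s, p, t, q` sees the whole cycle. -/
theorem _root_.ParagliderFree.adj_of_square (hG : ParagliderFree G) {v p q s t : V} (hne : p ≠ q)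
    (hpq : ¬ G.Adj p q) (hst : ¬ G.Adj s t) (hsp : G.Adj s p) (hsq : G.Adj s q) (htp : G.Adj t p)
    (htq : G.Adj t q) (hp : G.Adj v p) (hq : G.Adj v q) (hs : G.Adj v s) : G.Adj v t := by
  by_contra h
  exact hG.not_diamond hne hpq hp.symm hsp.symm hq.symm hsq.symm hs htp htq
    (fun h' => h h'.symm) (fun h' => hst h'.symm)

/-! ### Vertices outside a matched pair -/

namespace IsMatchedPair

variable {a b : ι → V}

theorem swap (h : G.IsMatchedPair a b) : G.IsMatchedPair b a :=
  ⟨h.right, h.left, fun i j => by rw [G.adj_comm, h.cross, eq_comm]⟩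

theorem injective_left (h : G.IsMatchedPair a b) : Function.Injective a := by
  intro i j hij
  by_contra hne
  exact G.ne_of_adj ((h.left i j).2 hne) hij

/-- In a third column, `a c` sees `a i` but not `b j`. -/
theorem left_ne_right (h : G.IsMatchedPair a b) (h3 : ∀ i j : ι, ∃ c, c ≠ i ∧ c ≠ j) (i j : ι) :
    a i ≠ b j := by
  intro hij
  obtain ⟨c, hci, hcj⟩ := h3 i j
  have := (h.left c i).2 hci
  rw [hij, h.cross] at this
  exact hcj this

/-- Two columns span the chordless 4-cycle `a i, a j, b j, b i`. -/
theorem adj_of_square (h : G.IsMatchedPair a b) (hpara : ParagliderFree G)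
    (h3 : ∀ i j : ι, ∃ c, c ≠ i ∧ c ≠ j) {v : V} {i j : ι} (hij : i ≠ j) (hi : G.Adj v (a i))
    (hj : G.Adj v (b j)) (hij' : G.Adj v (a j)) : G.Adj v (b i) := by
  refine hpara.adj_of_square (h.left_ne_right h3 i j) ?_ ?_ ?_ ?_ ?_ ?_ hi hj hij'
  all_goals simp [h.left, h.right, h.cross, h.swap.cross, hij, hij.symm]

/-- A vertex off a matched pair that sees two non-adjacent vertices of the pair sees the columns
of these two vertices and each third column. -/
theorem adj_columns (h : G.IsMatchedPair a b) (hhole : HoleFree G) (hpara : ParagliderFree G)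
    (h3 : ∀ i j : ι, ∃ c, c ≠ i ∧ c ≠ j)
    {v : V} (ha : ∀ i, v ≠ a i) (hb : ∀ i, v ≠ b i) {i j c : ι} (hij : i ≠ j) (hci : c ≠ i)
    (hcj : c ≠ j) (hi : G.Adj v (a i)) (hj : G.Adj v (b j)) :
    (G.Adj v (a j) ∧ G.Adj v (b i)) ∧ (G.Adj v (a c) ∧ G.Adj v (b c)) := by
  -- Otherwise `v, a i, a c, b c, b j` is a hole.
  have hole : ¬ (¬ G.Adj v (a c) ∧ ¬ G.Adj v (b c)) := by
    rintro ⟨h1, h2⟩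
    refine hhole.not_cycle_five hi (p := a c) (q := b c) (r := b j) ?_ ?_ ?_ hj.symm h1 h2 ?_ ?_ ?_
    all_goals simp [h.left, h.right, h.cross, hij, hci.symm, hcj]
  by_cases haj : G.Adj v (a j)
  · have hbi := h.adj_of_square hpara h3 hij hi hj haj
    have h1 : G.Adj v (a c) → G.Adj v (b c) := fun hc =>
      h.adj_of_square hpara h3 hci hc hbi hi
    have h2 : G.Adj v (b c) → G.Adj v (a c) := fun hc =>
      h.swap.adj_of_square hpara h3 hci hc hi hbi
    tauto
  · exfalso
    have hbi : ¬ G.Adj v (b i) := fun hbi =>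
      haj (h.swap.adj_of_square hpara h3 hij.symm hj hi hbi)
    by_cases hac : G.Adj v (a c)
    · by_cases hbc : G.Adj v (b c)
      · exact hbi (h.adj_of_square hpara h3 hci.symm hi hbc hac)
      -- The diamond on `v, a j, a i, a c` has fifth vertex `b j`; in the next case, `v, b i, b j, b
      -- c` has fifth vertex `a i`.
      · refine hpara.not_diamond (ha j) haj hi hac ?_ ?_ ?_ hj.symm ?_ ?_ ?_
        all_goals simp [h.left, h.swap.cross, hij.symm, hci.symm, hcj.symm]
    · refine hpara.not_diamond (hb i) hbi hj (not_not.1 fun hbc => hole ⟨hac, hbc⟩)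
        ?_ ?_ ?_ hi.symm ?_ ?_ ?_
      all_goals simp [h.right, h.cross, hij, hci.symm, hcj.symm]

/-- A vertex off a matched pair that sees two non-adjacent vertices of the pair sees all of it. -/
theorem adj_all (h : G.IsMatchedPair a b) (hhole : HoleFree G) (hpara : ParagliderFree G)
    (h3 : ∀ i j : ι, ∃ c, c ≠ i ∧ c ≠ j)
    {v : V} (ha : ∀ i, v ≠ a i) (hb : ∀ i, v ≠ b i) {i j : ι} (hij : i ≠ j)
    (hi : G.Adj v (a i)) (hj : G.Adj v (b j)) (c : ι) : G.Adj v (a c) ∧ G.Adj v (b c) := by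
  obtain ⟨d, hdi, hdj⟩ := h3 i j
  have h1 := (h.adj_columns hhole hpara h3 ha hb hij hdi hdj hi hj).1
  by_cases hci : c = i
  · subst hci; exact ⟨hi, h1.2⟩
  by_cases hcj : c = j
  · subst hcj; exact ⟨h1.1, hj⟩
  exact (h.adj_columns hhole hpara h3 ha hb hij hci hcj hi hj).2

/-- The vertices adjacent to a whole matched pair form a clique. -/
theorem adj_of_adj_all (h : G.IsMatchedPair a b) (hpara : ParagliderFree G)
    (h3 : ∀ i j : ι, ∃ c, c ≠ i ∧ c ≠ j) [Nonempty ι] {u v : V} (huv : u ≠ v)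
    (hu : ∀ c, G.Adj u (a c) ∧ G.Adj u (b c)) (hv : ∀ c, G.Adj v (a c) ∧ G.Adj v (b c)) :
    G.Adj u v := by
  by_contra hn
  obtain ⟨i⟩ := ‹Nonempty ι›
  obtain ⟨j, hj, -⟩ := h3 i i
  obtain ⟨c, hci, hcj⟩ := h3 i j
  refine hpara.not_diamond huv hn (hu i).1 (hu j).1 (hv i).1 (hv j).1 ?_ (hu c).2.symm
    (hv c).2.symm ?_ ?_
  all_goals simp [h.left, h.swap.cross, hj.symm, hci, hcj]

/-- The matched pair with a new column `x, y`. -/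
theorem cons {n : ℕ} {a b : Fin n → V} (h : G.IsMatchedPair a b) {x y : V} (hxy : G.Adj x y)
    (hxa : ∀ c, G.Adj x (a c)) (hyb : ∀ c, G.Adj y (b c)) (hxb : ∀ c, ¬ G.Adj x (b c))
    (hya : ∀ c, ¬ G.Adj y (a c)) :
    G.IsMatchedPair (Fin.cons x a : Fin (n + 1) → V) (Fin.cons y b : Fin (n + 1) → V) := by
  constructor
  all_goals
    intro i j
    cases i using Fin.cases <;> cases j using Fin.cases
    all_goals
      simp_all [h.left, h.right, h.cross, G.adj_comm, Fin.succ_ne_zero, (Fin.succ_ne_zero _).symm]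

end IsMatchedPair

/-! ### Shortest links -/

theorem IsLink.reverse {a b : ι → V} {X : Set V} {f : ℕ → V} {m : ℕ} (h : G.IsLink a b X f m) :
    G.IsLink b a X (fun t => f (m - t)) m := by
  obtain ⟨hX, hadj, i, j, hij, hi, hj⟩ := h
  refine ⟨fun t _ => hX _ (by omega), fun t ht => ?_, j, i, hij.symm, by simpa using hj,
    by simpa using hi⟩
  have := hadj (m - (t + 1)) (by omega)
  rw [show m - (t + 1) + 1 = m - t by omega] at this
  exact this.symm

/-- A stretch of a link between the neighbourhoods of non-adjacent vertices is a link. -/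
theorem IsLink.stretch {a b : ι → V} {X : Set V} {f : ℕ → V} {m : ℕ} (h : G.IsLink a b X f m)
    {s t : ℕ} (hst : s ≤ t) (ht : t ≤ m) {i j : ι} (hij : i ≠ j) (hi : G.Adj (a i) (f s))
    (hj : G.Adj (b j) (f t)) : G.IsLink a b X (fun r => f (s + r)) (t - s) :=
  ⟨fun r _ => h.1 _ (by omega), fun r _ => h.2.1 (s + r) (by omega), i, j, hij, hi, by
    simpa only [show s + (t - s) = t by omega] using hj⟩

/-- A shortest link is chordless. -/
theorem IsLink.isChordlessPath {a b : ι → V} {X : Set V} {f : ℕ → V} {m : ℕ}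
    (h : G.IsLink a b X f m) (hmin : ∀ k < m, ∀ g, ¬ G.IsLink a b X g k) :
    G.IsChordlessPath f m := by
  obtain ⟨hX, hadj, i, j, hij, hi, hj⟩ := h
  intro s t hst ht
  refine ⟨fun hc => ?_, fun hc => hc ▸ hadj s (by omega)⟩
  by_contra hne
  -- The chord bypasses the `t - s - 1` terms strictly between `f s` and `f t`.
  refine hmin (m - (t - s - 1)) (by omega)
    (fun r => if r ≤ s then f r else f (r + (t - s - 1))) ⟨?_, ?_, i, j, hij, by simpa using hi, ?_⟩
  · intro r hr
    dsimp only
    split_ifs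
    · exact hX _ (by omega)
    · exact hX _ (by omega)
  · intro r hr
    rcases lt_trichotomy r s with hrs | rfl | hrs
    · simp only [hrs.le, Nat.succ_le_of_lt hrs, if_true]
      exact hadj r (by omega)
    · simp only [le_refl, if_true, show ¬ r + 1 ≤ r by omega, if_false]
      rwa [show r + 1 + (t - r - 1) = t by omega]
    · simp only [show ¬ r ≤ s by omega, show ¬ r + 1 ≤ s by omega, if_false]
      rw [show r + 1 + (t - s - 1) = r + (t - s - 1) + 1 by omega]
      exact hadj _ (by omega)
  · simp only [show ¬ m - (t - s - 1) ≤ s by omega, if_false]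
    rwa [show m - (t - s - 1) + (t - s - 1) = m by omega]

/-- In a hole-free graph, a shortest link is an edge whose ends form a new column. -/
theorem IsLink.exists_column {a b : ι → V} (h : G.IsMatchedPair a b) (hhole : HoleFree G)
    (h3 : ∀ i j : ι, ∃ c, c ≠ i ∧ c ≠ j) {X : Set V}
    (hX : ∀ v ∈ X, ∀ i j, G.Adj (a i) v → G.Adj (b j) v → i = j) {f : ℕ → V} {m : ℕ}
    (hf : G.IsLink a b X f m) (hmin : ∀ k < m, ∀ g, ¬ G.IsLink a b X g k) :
    ∃ x y, G.Adj x y ∧ x ∈ X ∧ y ∈ X ∧ (∀ c, G.Adj x (a c)) ∧ (∀ c, G.Adj y (b c)) := by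
  have hpath := hf.isChordlessPath hmin
  -- The stretch between `f s` and `f t`, reversed if need be, is a link, so by minimality it has
  -- all `m` steps.
  have key : ∀ s ≤ m, ∀ t ≤ m, ∀ i j, i ≠ j → G.Adj (a i) (f s) → G.Adj (b j) (f t) →
      s + m ≤ t ∨ t + m ≤ s := by
    intro s hs t ht i j hij hi hj
    by_contra hlt
    rcases le_total s t with hst | hst
    · exact hmin _ (by omega) _ (hf.stretch hst ht hij hi hj)
    · have h1 : G.IsLink b a X (fun r => f (t + r)) (s - t) :=
        ⟨fun r _ => hf.1 _ (by omega), fun r _ => hf.2.1 (t + r) (by omega), j, i, hij.symm, hj, by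
          simpa only [show t + (s - t) = s by omega] using hi⟩
      exact hmin _ (by omega) _ h1.reverse
  obtain ⟨hfX, hadj, i, j, hij, hi, hj⟩ := hf
  have hm : 1 ≤ m := by
    by_contra hm
    obtain rfl : m = 0 := by omega
    exact hij (hX _ (hfX 0 le_rfl) _ _ hi hj)
  have hi' : ∀ s ≤ m, (G.Adj (a i) (f s) ↔ s = 0) := fun s hs =>
    ⟨fun hc => by have := key s hs m le_rfl i j hij hc hj; omega, fun hc => hc ▸ hi⟩
  have hj' : ∀ s ≤ m, (G.Adj (b j) (f s) ↔ s = m) := fun s hs =>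
    ⟨fun hc => by have := key 0 (by omega) s hs i j hij hi hc; omega, fun hc => hc ▸ hj⟩
  -- Otherwise `b j, a j, a i` closes the path to a hole; for `hij'`, it is `b j, b i, a i`.
  have hji' : ∃ s ≤ m, G.Adj (a j) (f s) := by
    by_contra! hn
    refine hhole.not_closed_path hm hpath hj' hn hi' ?_ ?_ ?_
    all_goals simp [h.left, h.cross, hij]
  have hij' : ∃ t ≤ m, G.Adj (b i) (f t) := by
    by_contra! hn
    refine hhole.not_closed_path hm hpath hj' hn hi' ?_ ?_ ?_
    all_goals simp [h.right, h.cross, hij]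
  obtain ⟨s, hs, hsj⟩ := hji'
  obtain ⟨t, ht, hti⟩ := hij'
  -- Either `f 0` sees `a i, a j` and `f m` sees `b i, b j`, or `f 0` sees `a i, b i` and `f m` sees
  -- `a j, b j`. The second case always leaves a hole.
  rcases key s hs t ht j i hij.symm hsj hti with hst | hst
  · obtain rfl : s = 0 := by omega
    obtain rfl : t = m := by omega
    by_cases hm2 : 2 ≤ t
    · refine (hhole.not_closed_edge hm2 hpath hj' (q := a j) ?_ (by simp [h.cross])).elim
      exact fun s hs =>
        ⟨fun hc => by have := key s hs t le_rfl j i hij.symm hc hti; omega, fun hc => hc ▸ hsj⟩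
    obtain rfl : t = 1 := by omega
    have h01 : G.Adj (f 0) (f 1) := hadj 0 (by omega)
    have hx := hX _ (hfX 0 (by omega))
    have hy := hX _ (hfX 1 le_rfl)
    have hxb : ∀ c, ¬ G.Adj (b c) (f 0) := fun c hc =>
      hij ((hx _ _ hi hc).trans (hx _ _ hsj hc).symm)
    have hya : ∀ c, ¬ G.Adj (a c) (f 1) := fun c hc =>
      hij ((hy _ _ hc hti).symm.trans (hy _ _ hc hj))
    have hboth : ∀ c, G.Adj (a c) (f 0) ∧ G.Adj (b c) (f 1) := by
      intro c
      by_cases hci : c = i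
      · subst hci; exact ⟨hi, hti⟩
      by_cases hcj : c = j
      · subst hcj; exact ⟨hsj, hj⟩
      have hci' : i ≠ c := fun h => hci h.symm
      have hcj' : j ≠ c := fun h => hcj h.symm
      -- Any missing adjacency puts column `c` on a hole of length five or six.
      by_cases h1 : G.Adj (a c) (f 0) <;> by_cases h2 : G.Adj (b c) (f 1)
      · exact ⟨h1, h2⟩
      · refine (hhole.not_cycle_five (x := b c) (y := a c) (p := f 0) (q := f 1) (r := b i)
          ?_ h1 h01 hti.symm ?_ (hxb c) h2 (hya c) ?_ (fun h => hxb i h.symm)).elim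
        all_goals simp [h.right, h.swap.cross, h.cross, hci, hci']
      · refine (hhole.not_cycle_five (x := a c) (y := b c) (p := f 1) (q := f 0) (r := a i)
          ?_ h2 h01.symm hi.symm ?_ (hya c) h1 (hxb c) ?_ (fun h => hya i h.symm)).elim
        all_goals simp [h.left, h.swap.cross, h.cross, hci, hci']
      · refine (hhole.not_cycle_six (x := f 0) (y := a i) (z := a c) (p := b c) (q := b j)
          (r := f 1) hi.symm ?_ ?_ ?_ hj h01.symm (fun h => h1 h.symm) (fun h => hxb c h.symm)
          (fun h => hxb j h.symm) ?_ ?_ (hya i) ?_ (hya c) h2).elim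
        all_goals simp [h.left, h.right, h.cross, hci', hcj, hij]
    exact ⟨f 0, f 1, h01, hfX 0 (by omega), hfX 1 le_rfl, fun c => (hboth c).1.symm,
      fun c => (hboth c).2.symm⟩
  · exfalso
    obtain rfl : t = 0 := by omega
    obtain rfl : s = m := by omega
    by_cases hm2 : 2 ≤ s
    · refine hhole.not_closed_edge hm2 hpath (p := a j) (q := a i) ?_ hi' (by simp [h.left, hij])
      exact fun r hr =>
        ⟨fun hc => by have := key r hr 0 (by omega) j i hij.symm hc hti; omega, fun hc => hc ▸ hsj⟩
    obtain rfl : s = 1 := by omega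
    have h01 : G.Adj (f 0) (f 1) := hadj 0 (by omega)
    have hx := hX _ (hfX 0 (by omega))
    have hy := hX _ (hfX 1 le_rfl)
    obtain ⟨c, hci, hcj⟩ := h3 i j
    refine hhole.not_cycle_six (x := a j) (y := a c) (z := b c) (p := b i) (q := f 0) (r := f 1)
      ?_ ?_ ?_ hti h01 hsj.symm ?_ ?_ (fun h => hij (hx _ _ h hti).symm) ?_
      (fun h => hci (hx _ _ h hti)) (fun h => hcj (hy _ _ h hj)) (fun h => hci (hx _ _ hi h).symm)
      (fun h => hcj (hy _ _ hsj h).symm) (fun h => hij (hy _ _ hsj h).symm)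
    all_goals simp [h.left, h.right, h.cross, hci, hcj.symm, hij.symm]

/-! ### The clique separator -/

theorem Walk.isLink {a b : ι → V} {X : Set V} {u v : V} (p : G.Walk u v)
    (hp : ∀ z ∈ p.support, z ∈ X) {i j : ι} (hij : i ≠ j) (hi : G.Adj (a i) u)
    (hj : G.Adj (b j) v) : G.IsLink a b X p.getVert p.length :=
  ⟨fun _ _ => hp _ (p.getVert_mem_support _), fun _ ht => p.adj_getVert_succ ht, i, j, hij,
    by simpa using hi, by simpa using hj⟩

/-- The vertices of `G` off a matched pair that do not see all of it. -/
def restOf (G : SimpleGraph V) (a b : ι → V) : Set V :=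
  {v | (∀ i, v ≠ a i) ∧ (∀ i, v ≠ b i) ∧ ¬ ∀ c, G.Adj v (a c) ∧ G.Adj v (b c)}

/-- Without links outside, a matched pair and the vertices that see all of it are everything. -/
theorem IsMatchedPair.restOf_eq_empty {a b : ι → V} (h : G.IsMatchedPair a b)
    (hpara : ParagliderFree G) (h3 : ∀ i j : ι, ∃ c, c ≠ i ∧ c ≠ j) [Nonempty ι]
    (hconn : G.Connected) (hatom : IsAtomGraph G)
    (hlink : ∀ f m, ¬ G.IsLink a b (G.restOf a b) f m) : G.restOf a b = ∅ := by
  by_contra hne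
  obtain ⟨x, hx⟩ := Set.nonempty_iff_ne_empty.2 hne
  set X := G.restOf a b
  -- `C` is the component of `x` in `G[X]`; `K` is `U` together with the vertices of the pair that
  -- have a neighbour in `C`.
  let C : Set V := {y | ∃ p : G.Walk x y, ∀ z ∈ p.support, z ∈ X}
  let U : Set V := {v | ∀ c, G.Adj v (a c) ∧ G.Adj v (b c)}
  let K : Set V := U ∪ {v | ((∃ i, v = a i) ∨ ∃ i, v = b i) ∧ ∃ y ∈ C, G.Adj v y}
  have hxC : x ∈ C := ⟨Walk.nil, by simpa using hx⟩
  have hCX : C ⊆ X := fun y ⟨p, hp⟩ => hp y p.end_mem_support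
  have hCK : ∀ y ∈ C, y ∉ K := by
    rintro y hy (hU | ⟨⟨i, hi⟩ | ⟨i, hi⟩, -⟩)
    · exact (hCX hy).2.2 hU
    · exact (hCX hy).1 i hi
    · exact (hCX hy).2.1 i hi
  have hcross : ∀ i j, i ≠ j → (∃ y ∈ C, G.Adj (a i) y) → (∃ y ∈ C, G.Adj (b j) y) → False := by
    rintro i j hij ⟨y, ⟨p, hp⟩, hy⟩ ⟨z, ⟨q, hq⟩, hz⟩
    refine hlink _ _ ((p.reverse.append q).isLink (fun w hw => ?_) hij hy hz)
    rw [Walk.mem_support_append_iff, Walk.support_reverse, List.mem_reverse] at hw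
    exact hw.elim (hp w) (hq w)
  have hK : G.IsClique K := by
    rintro u hu v hv huv
    rcases hu with hu | ⟨⟨i, rfl⟩ | ⟨i, rfl⟩, hu⟩ <;> rcases hv with hv | ⟨⟨j, rfl⟩ | ⟨j, rfl⟩, hv⟩
    · exact h.adj_of_adj_all hpara h3 huv hu hv
    · exact (hu j).1
    · exact (hu j).2
    · exact (hv i).1.symm
    · exact (h.left i j).2 fun hij => huv (congrArg a hij)
    · exact (h.cross i j).2 (by_contra fun hij => hcross i j hij hu hv)
    · exact (hv i).2.symm
    · exact (h.swap.cross i j).2 (by_contra fun hij => hcross j i (Ne.symm hij) hv hu)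
    · exact (h.right i j).2 fun hij => huv (congrArg b hij)
  have hclosed : ∀ (u v : ↥Kᶜ) (_ : (G.induce Kᶜ).Walk u v), u.1 ∈ C → v.1 ∈ C := by
    intro u v w
    induction w with
    | nil => exact id
    | @cons u v w huv _ ih =>
      rintro hu
      refine ih ?_
      have huv : G.Adj u.1 v.1 := huv
      have hvX : v.1 ∈ X := by
        refine ⟨fun i hi => v.2 (Or.inr ⟨Or.inl ⟨i, hi⟩, u.1, hu, huv.symm⟩),
          fun i hi => v.2 (Or.inr ⟨Or.inr ⟨i, hi⟩, u.1, hu, huv.symm⟩), fun hv => v.2 (Or.inl hv)⟩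
      obtain ⟨p, hp⟩ := hu
      refine ⟨p.concat huv, fun z hz => ?_⟩
      rw [Walk.support_concat, List.mem_append, List.mem_singleton] at hz
      rcases hz with hz | rfl
      · exact hp z hz
      · exact hvX
  -- The clique `K` cannot contain both of the non-adjacent vertices `a i` and `b j`.
  obtain ⟨y, hyK, hyX⟩ : ∃ y, y ∉ K ∧ y ∉ X := by
    obtain ⟨i⟩ := ‹Nonempty ι›
    obtain ⟨j, hji, -⟩ := h3 i i
    by_cases hi : a i ∈ K
    · refine ⟨b j, fun hj => ?_, fun hj => hj.2.1 j rfl⟩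
      have := hK hi hj (h.left_ne_right h3 i j)
      exact hji ((h.cross i j).1 this).symm
    · exact ⟨a i, hi, fun hj => hj.1 i rfl⟩
  refine hatom K ⟨hK, ?_⟩
  have := hconn.preconnected.subsingleton_connectedComponent
  refine (Cardinal.le_one_iff_subsingleton.2 this).trans_lt (Cardinal.one_lt_iff_nontrivial.2 ?_)
  refine ⟨(G.induce Kᶜ).connectedComponentMk ⟨x, hCK x hxC⟩,
    (G.induce Kᶜ).connectedComponentMk ⟨y, hyK⟩, fun he => ?_⟩
  obtain ⟨w⟩ := ConnectedComponent.exact he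
  exact hyX (hCX (hclosed _ _ w hxC))

/-! ### Maximal matched pairs and the conclusion -/

/-- `G` has a matched pair with `n` columns that covers `A` and has two columns inside `A`. -/
def HasMatchedPair (G : SimpleGraph V) (A : Set V) (n : ℕ) : Prop :=
  ∃ a b : Fin n → V, G.IsMatchedPair a b ∧ A ⊆ Set.range a ∪ Set.range b ∧
    ∃ i j, i ≠ j ∧ a i ∈ A ∧ a j ∈ A ∧ b i ∈ A ∧ b j ∈ A

theorem HasMatchedPair.le_card [Finite V] {A : Set V} {n : ℕ} (h : G.HasMatchedPair A n) :
    n ≤ Nat.card V := by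
  obtain ⟨a, b, h, -⟩ := h
  simpa using Nat.card_le_card_of_injective a h.injective_left

/-- The even and the odd vertices of the 6-cycle are the two cliques of its complement; antipodal
vertices are matched. -/
theorem _root_.InducesCoC6.hasMatchedPair {A : Set V} (hA : InducesCoC6 G A) :
    G.HasMatchedPair A 3 := by
  obtain ⟨e⟩ := hA
  have hadj : ∀ i j : Fin 6, G.Adj (e.symm i) (e.symm j) ↔ (cycleGraph 6)ᶜ.Adj i j := fun i j =>
    e.symm.map_adj_iff
  refine ⟨fun i => e.symm (![0, 2, 4] i), fun i => e.symm (![3, 5, 1] i), ⟨?_, ?_, ?_⟩, ?_,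
    0, 1, by decide, Subtype.coe_prop _, Subtype.coe_prop _, Subtype.coe_prop _,
    Subtype.coe_prop _⟩
  · intro i j
    rw [hadj]
    revert i j
    decide
  · intro i j
    rw [hadj]
    revert i j
    decide
  · intro i j
    rw [hadj]
    revert i j
    decide
  · intro v hv
    have hcov : ∀ k : Fin 6, (∃ i, ![0, 2, 4] i = k) ∨ ∃ i, ![3, 5, 1] i = k := by decide
    rcases hcov (e ⟨v, hv⟩) with ⟨i, hi⟩ | ⟨i, hi⟩
    · exact Or.inl ⟨i, by simp only [hi, e.symm_apply_apply]⟩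
    · exact Or.inr ⟨i, by simp only [hi, e.symm_apply_apply]⟩

theorem exists_maximal_hasMatchedPair [Finite V] {A : Set V} (hA : InducesCoC6 G A) :
    ∃ n, 3 ≤ n ∧ G.HasMatchedPair A n ∧ ¬ G.HasMatchedPair A (n + 1) := by
  classical
  have h3 := hA.hasMatchedPair
  refine ⟨Nat.findGreatest (G.HasMatchedPair A) (Nat.card V), Nat.le_findGreatest h3.le_card h3,
    Nat.findGreatest_spec h3.le_card h3, fun h => ?_⟩
  have := Nat.le_findGreatest h.le_card h
  omega

/-- An induced subgraph on the vertices of a matched pair is matched co-bipartite. -/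
theorem IsMatchedPair.isMatchedCoBipartite {a b : ι → V} (h : G.IsMatchedPair a b)
    (h3 : ∀ i j : ι, ∃ c, c ≠ i ∧ c ≠ j) {S : Set V} (hS : S = Set.range a ∪ Set.range b) :
    IsMatchedCoBipartite (G.induce S) := by
  let a' : ι → S := fun i => ⟨a i, by simp [hS]⟩
  let b' : ι → S := fun i => ⟨b i, by simp [hS]⟩
  have ha' : Function.Injective a' := fun i j hij => h.injective_left (congrArg Subtype.val hij)
  have hb' : Function.Injective b' := fun i j hij =>
    h.swap.injective_left (congrArg Subtype.val hij)
  refine ⟨Set.range a', Set.range b', ?_, ?_, ?_, ?_,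
    (Equiv.ofInjective a' ha').symm.trans (Equiv.ofInjective b' hb'), ?_⟩
  · refine Set.eq_univ_of_forall fun ⟨v, hv⟩ => ?_
    rcases hS ▸ hv with ⟨i, hi⟩ | ⟨i, hi⟩
    · exact Or.inl ⟨i, Subtype.ext hi⟩
    · exact Or.inr ⟨i, Subtype.ext hi⟩
  · rw [Set.disjoint_left]
    rintro _ ⟨i, rfl⟩ ⟨j, hij⟩
    exact h.left_ne_right h3 i j (congrArg Subtype.val hij).symm
  · rintro _ ⟨i, rfl⟩ _ ⟨j, rfl⟩ hij
    exact (h.left i j).2 fun h => hij (congrArg a' h)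
  · rintro _ ⟨i, rfl⟩ _ ⟨j, rfl⟩ hij
    exact (h.right i j).2 fun h => hij (congrArg b' h)
  · rintro ⟨_, i, rfl⟩ ⟨_, j, rfl⟩
    rw [Equiv.trans_apply, Equiv.ofInjective_symm_apply, Subtype.ext_iff, Equiv.ofInjective_apply,
      hb'.eq_iff]
    exact h.cross i j

end SimpleGraph

theorem mainTheorem1 {V : Type*} [Finite V] (G : SimpleGraph V) (hconn : G.Connected)
    (hhole : HoleFree G) (hpara : ParagliderFree G) (hatom : IsAtomGraph G)
    (A : Set V) (hA : InducesCoC6 G A) :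
    IsMatchedCoBipartite (G.induce (universalVertices G A)ᶜ) := by
  obtain ⟨n, hn, ⟨a, b, h, hcov, i, j, hij, hai, haj, hbi, hbj⟩, hmax⟩ :=
    SimpleGraph.exists_maximal_hasMatchedPair hA
  have h3 : ∀ i j : Fin n, ∃ c, c ≠ i ∧ c ≠ j := fun i j => by
    obtain ⟨c, hc⟩ := Finset.exists_mem_notMem_of_card_lt_card
      (s := {i, j}) (t := (Finset.univ : Finset (Fin n)))
      (Finset.card_le_two.trans_lt (by simpa using Nat.lt_of_succ_le hn))
    exact ⟨c, by simpa using hc⟩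
  have : Nonempty (Fin n) := ⟨i⟩
  have hX : ∀ v ∈ G.restOf a b, ∀ i j, G.Adj (a i) v → G.Adj (b j) v → i = j := by
    intro v hv i j hi hj
    by_contra hij
    exact hv.2.2 (h.adj_all hhole hpara h3 hv.1 hv.2.1 hij hi.symm hj.symm)
  have hlink : ∀ f m, ¬ G.IsLink a b (G.restOf a b) f m := by
    classical
    by_contra! hex
    have hex : ∃ m f, G.IsLink a b (G.restOf a b) f m := exists_comm.1 hex
    obtain ⟨f, hf⟩ := Nat.find_spec hex
    obtain ⟨x, y, hxy, hx, hy, hxa, hyb⟩ :=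
      hf.exists_column h hhole h3 hX (fun k hk g hg => Nat.find_min hex hk ⟨g, hg⟩)
    -- As `x` sees both `a i` and `a j`, a neighbour `b c` would force `c = i` and `c = j`.
    have hxb : ∀ c, ¬ G.Adj x (b c) := fun c hc =>
      hij ((hX x hx i c (hxa i).symm hc.symm).trans (hX x hx j c (hxa j).symm hc.symm).symm)
    have hya : ∀ c, ¬ G.Adj y (a c) := fun c hc =>
      hij ((hX y hy c i hc.symm (hyb i).symm).symm.trans (hX y hy c j hc.symm (hyb j).symm))
    refine hmax ⟨_, _, h.cons hxy hxa hyb hxb hya, hcov.trans ?_, i.succ, j.succ, ?_, ?_⟩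
    · rw [Fin.range_cons, Fin.range_cons]
      exact Set.union_subset_union (Set.subset_insert _ _) (Set.subset_insert _ _)
    · simpa using hij
    · simpa using ⟨hai, haj, hbi, hbj⟩
  have hrest := h.restOf_eq_empty hpara h3 hconn hatom hlink
  refine h.isMatchedCoBipartite h3 (Set.ext fun v => ⟨fun hv => ?_, ?_⟩)
  · by_contra hv'
    have hv'' : v ∉ G.restOf a b := by simp [hrest]
    refine hv'' ⟨fun i hi => hv' (Or.inl ⟨i, hi.symm⟩), fun i hi => hv' (Or.inr ⟨i, hi.symm⟩),
      fun hall => hv fun w hw => ?_⟩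
    rcases hcov hw with ⟨c, rfl⟩ | ⟨c, rfl⟩
    · exact (hall c).1
    · exact (hall c).2
  · rintro (⟨c, rfl⟩ | ⟨c, rfl⟩) hc
    -- Two columns inside `A` are needed here: `a c` sees only one of `b i`, `b j`, so no vertex of
    -- the pair is in `A_6`.
    · exact hij (((h.cross c i).1 (hc _ hbi)).symm.trans ((h.cross c j).1 (hc _ hbj)))
    · exact hij (((h.swap.cross c i).1 (hc _ hai)).symm.trans ((h.swap.cross c j).1 (hc _ haj)))
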